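/- There is a universal constant $C>0$ with the following property. Let $n,N,m$ be nonnegative integers, let $A_0\in\mathbb C^{n\times n}$ be a unitary matrix with rows $a_1^*,\dots,a_n^*$ (so $a_k\in\mathbb C^n$ is a column vector), let $\pi=(\pi_k)_{1\le k\le n}$ be a probability distribution on $\{1,\dots,n\}$, and let $\{1,\dots,n\}=\bigsqcup_{i=1}^N\Omega_i$ be a partition into levels. Let $S\subset\{1,\dots,n\}$ have cardinality $s\ge 2$, put $s_i=|S\cap\Omega_i|$ for $1\le i\le N$, let $x\in\mathbb C^n$ satisfy $x_j=0$ for all $j\notin S$, and let $\varepsilon\in(0,1)$. Let $K_1,\dots,K_m$ be independent random variables with $\mathbb P(K_\ell=k)=\pi_k$ for $1\le k\le n$, and let $$A=\frac1{\sqrt m}\Big(\frac1{\sqrt{\pi_{K_\ell}}}\,a_{K_\ell}^*\Big)_{1\le\ell\le m}\in\mathbb C^{m\times n}$$ be the random sensing matrix of isolated measurements. For $v\in\mathbb C^n$ and $T\subset\{1,\dots,n\}$ write $v_T$ for the vector that agrees with $v$ on $T$ and vanishes off $T$, and write $a_{k,T}=(a_k)_T$. If $$m\ \ge\ C\left(\max_{1\le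 k\le n}\frac{\sum_{\ell=1}^N s_\ell\,\|a_{k,\Omega_\ell}\|_\infty\,\|a_k\|_\infty}{\pi_k}\right)\ln(s)\,\ln\!\Big(\frac n\varepsilon\Big)$$ and $$m\ \ge\ C\left(\max_{1\le i\le n}\ \sup_{v\in\mathbb C^n,\ \|v\|_\infty\le1}\ \sum_{k=1}^n\frac1{\pi_k}\,|e_i^*a_k|^2\,|a_{k,S}^*v|^2\right)\ln(s)\,\ln\!\Big(\frac n\varepsilon\Big),$$ then, with probability at least $1-\varepsilon$, the vector $x$ is the unique solution of $$\min_{z\in\mathbb C^n,\ Az=Ax}\|z\|_1 .$$ Here the two maxima are taken in $[0,\infty]$; where $\pi_k=0$, a quotient with denominator $\pi_k$ is $0$ if its numerator is $0$ and $\infty$ otherwise. -/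

import Mathlib

open scoped ENNReal

namespace IsolatedCS

/-- The coordinate projection `v_S = P_S v`. -/
noncomputable def restrict {n : ℕ} (S : Finset (Fin n)) (v : Fin n → ℂ) : Fin n → ℂ :=
  fun j => if j ∈ S then v j else 0

/-- The vector `a_k`, i.e. the column vector such that `a_k^*` is the `k`-th row of `A₀`. -/
def rowVec {n : ℕ} (A₀ : Matrix (Fin n) (Fin n) ℂ) (k : Fin n) : Fin n → ℂ :=
  star (A₀ k)

/-- The sensing matrix of isolated measurements: its `ℓ`-th row is
`(1/√m) (1/√π_{K_ℓ}) a_{K_ℓ}^*`. -/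
noncomputable def sensingMatrix {n : ℕ} (A₀ : Matrix (Fin n) (Fin n) ℂ) (π : Fin n → ℝ)
    (m : ℕ) (K : Fin m → Fin n) : Matrix (Fin m) (Fin n) ℂ :=
  Matrix.of fun ℓ j =>
    ((1 / Real.sqrt m : ℝ) : ℂ) * ((1 / Real.sqrt (π (K ℓ)) : ℝ) : ℂ) *
      star (rowVec A₀ (K ℓ) j)

/-- The `ℓ¹` norm on `ℂⁿ`. -/
noncomputable def l1Norm {n : ℕ} (z : Fin n → ℂ) : ℝ := ∑ j, ‖z j‖

/-- `x` is the unique solution of: minimize `‖z‖₁` over all `z` with `A z = y`. -/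
def IsUniqueL1Solution {m n : ℕ} (A : Matrix (Fin m) (Fin n) ℂ) (y : Fin m → ℂ)
    (x : Fin n → ℂ) : Prop :=
  A.mulVec x = y ∧ ∀ z : Fin n → ℂ, A.mulVec z = y → z ≠ x → l1Norm x < l1Norm z

/-- `max_k (∑_ℓ s_ℓ ‖a_{k,Ω_ℓ}‖_∞ ‖a_k‖_∞) / π_k`.  The norm on `Fin n → ℂ` is the sup norm.
The value is taken in `[0,∞]`, where `0 / 0 = 0` and `c / 0 = ∞` for `c > 0`. -/
noncomputable def levelCoherence {n N : ℕ} (A₀ : Matrix (Fin n) (Fin n) ℂ) (π : Fin n → ℝ)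
    (Lev : Fin N → Finset (Fin n)) (sLev : Fin N → ℕ) : ℝ≥0∞ :=
  ⨆ k : Fin n,
    ENNReal.ofReal (∑ ℓ, (sLev ℓ : ℝ) * ‖restrict (Lev ℓ) (rowVec A₀ k)‖ * ‖rowVec A₀ k‖) /
      ENNReal.ofReal (π k)

/-- `max_i sup_{‖v‖_∞ ≤ 1} ∑_k (1/π_k) |e_i^* a_k|² |a_{k,S}^* v|²`.  The norm on `Fin n → ℂ` is
the sup norm.  The value is taken in `[0,∞]`, where `0 / 0 = 0` and `c / 0 = ∞` for `c > 0`. -/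
noncomputable def upsilon {n : ℕ} (A₀ : Matrix (Fin n) (Fin n) ℂ) (π : Fin n → ℝ)
    (S : Finset (Fin n)) : ℝ≥0∞ :=
  ⨆ (i : Fin n) (v : Fin n → ℂ) (_ : ‖v‖ ≤ 1), ∑ k : Fin n,
    ENNReal.ofReal
        (‖rowVec A₀ k i‖ ^ 2 * ‖star (restrict S (rowVec A₀ k)) ⬝ᵥ v‖ ^ 2) /
      ENNReal.ofReal (π k)

end IsolatedCS

/-! The proof is a golfing scheme using only scalar concentration. Write `h = z - x` for a
competitor's displacement, a kernel vector of the sensing matrix. For `v` supported on `S`, the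
empirical mean of `π_k⁻¹ a_k a_k^* v` over a batch of draws is orthogonal to `h` and has expectation
`v`. Hence `⟨v, h⟩ = ⟨e, h⟩`, where `e` is the sampling error. If every coordinate of `e` is at most
`1/4`, the part of `e` on `S` is a quarter of a new vector in the unit ball, and the part off `S`
costs `‖h_{Sᶜ}‖₁ / 4`. Iterating over `L` disjoint batches bounds `|⟨v, h⟩|` by `4^{-L} ‖h_S‖₁ +
‖h_{Sᶜ}‖₁ / 3` (`norm_star_dotProduct_le`).

This is applied to the sign pattern of `x` and to each unit vector `e_j`, `j ∈ S`, with the same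
batches. The unit vectors control `‖h_S‖₁` by `‖h_{Sᶜ}‖₁`, a role usually played by a local
isometry, and the sign pattern then gives the strict inequality (`l1Norm_lt_of_certificates`).

The two conditions on `m` bound the samples and their second moments by a common `R`, so Bernstein's
inequality controls each coordinate of each step (`measureReal_golfFailure_le`). With about `ln s`
batches of size about `R ln(n/ε)`, a union bound over targets, steps and coordinates finishes the
proof. -/

namespace IsolatedCS

open MeasureTheory ProbabilityTheory

/-! ### Scalar concentration -/

/-- If `Y` is independent of `X` and each fixed section is hit by `Y` with probability at most `δ`,
then so is the section selected by `X`. -/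
theorem measureReal_section_le_of_indepFun {Ω α β : Type*} [MeasurableSpace Ω] {P : Measure Ω}
    [IsProbabilityMeasure P] [Fintype α] [MeasurableSpace α] [MeasurableSingletonClass α]
    [MeasurableSpace β] [DiscreteMeasurableSpace β] {X : Ω → α} {Y : Ω → β}
    (hX : Measurable X) (hXY : IndepFun X Y P) (E : α → Set β) {δ : ℝ}
    (hE : ∀ a, P.real {ω | Y ω ∈ E a} ≤ δ) :
    P.real {ω | Y ω ∈ E (X ω)} ≤ δ := by
  have hsub : {ω | Y ω ∈ E (X ω)} ⊆ ⋃ a, (X ⁻¹' {a} ∩ Y ⁻¹' (E a)) := by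
    intro ω hω
    exact Set.mem_iUnion.2 ⟨X ω, rfl, hω⟩
  have hone : ∑ a : α, P.real (X ⁻¹' {a}) = 1 := by
    rw [sum_measureReal_preimage_singleton Finset.univ fun y _ => hX (measurableSet_singleton y)]
    simp
  calc P.real {ω | Y ω ∈ E (X ω)}
      ≤ P.real (⋃ a, (X ⁻¹' {a} ∩ Y ⁻¹' (E a))) := measureReal_mono hsub
    _ ≤ ∑ a, P.real (X ⁻¹' {a} ∩ Y ⁻¹' (E a)) := measureReal_iUnion_fintype_le _
    _ ≤ ∑ a, P.real (X ⁻¹' {a}) * δ := by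
        refine Finset.sum_le_sum fun a _ => ?_
        have h := hXY.measure_inter_preimage_eq_mul {a} (E a) (measurableSet_singleton a)
          (MeasurableSet.of_discrete)
        have h' : P.real (X ⁻¹' {a} ∩ Y ⁻¹' (E a)) = P.real (X ⁻¹' {a}) * P.real (Y ⁻¹' (E a)) := by
          simp only [measureReal_def, h, ENNReal.toReal_mul]
        rw [h']
        exact mul_le_mul_of_nonneg_left (hE a) measureReal_nonneg
    _ = δ := by rw [← Finset.sum_mul, hone, one_mul]

theorem integral_comp_eq_sum {Ω : Type*} [MeasurableSpace Ω] {P : Measure Ω}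
    [IsProbabilityMeasure P] {n : ℕ} {π : Fin n → ℝ} (hπ : ∀ k, 0 ≤ π k) {X : Ω → Fin n}
    (hX : Measurable X) (hlaw : ∀ k, P {ω | X ω = k} = ENNReal.ofReal (π k)) (g : Fin n → ℝ) :
    ∫ ω, g (X ω) ∂P = ∑ k, π k * g k := by
  have : IsProbabilityMeasure (P.map X) := Measure.isProbabilityMeasure_map hX.aemeasurable
  rw [← integral_map hX.aemeasurable (Measurable.of_discrete).aestronglyMeasurable,
    integral_fintype Integrable.of_finite]
  refine Finset.sum_congr rfl fun k _ => ?_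
  have : (P.map X).real {k} = π k := by
    rw [map_measureReal_apply hX (measurableSet_singleton k), measureReal_def]
    have : X ⁻¹' {k} = {ω | X ω = k} := rfl
    rw [this, hlaw, ENNReal.toReal_ofReal (hπ k)]
  rw [this, smul_eq_mul]

/-- The moment generating function of a bounded variable, in Bernstein form. -/
theorem sum_mul_exp_le {n : ℕ} {π : Fin n → ℝ} (hπ : ∀ k, 0 ≤ π k) (hπ1 : ∑ k, π k = 1)
    (g : Fin n → ℝ) {R c : ℝ} (hbd : ∀ k, |c * g k| ≤ 1)
    (hvar : ∑ k, π k * g k ^ 2 ≤ R) :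
    ∑ k, π k * Real.exp (c * g k) ≤ Real.exp (c * ∑ k, π k * g k + c ^ 2 * R) := by
  have h1 : ∀ k, π k * Real.exp (c * g k) ≤ π k + c * (π k * g k) + c ^ 2 * (π k * g k ^ 2) := by
    intro k
    have := (abs_le.1 (Real.abs_exp_sub_one_sub_id_le (hbd k))).2
    have h2 : Real.exp (c * g k) ≤ 1 + c * g k + (c * g k) ^ 2 := by linarith
    calc _ ≤ π k * (1 + c * g k + (c * g k) ^ 2) := mul_le_mul_of_nonneg_left h2 (hπ k)
      _ = _ := by ring
  calc _ ≤ ∑ k, (π k + c * (π k * g k) + c ^ 2 * (π k * g k ^ 2)) :=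
        Finset.sum_le_sum fun k _ => h1 k
    _ = 1 + c * ∑ k, π k * g k + c ^ 2 * ∑ k, π k * g k ^ 2 := by
        rw [Finset.sum_add_distrib, Finset.sum_add_distrib, ← Finset.mul_sum, ← Finset.mul_sum, hπ1]
    _ ≤ (c * ∑ k, π k * g k + c ^ 2 * R) + 1 := by
        have := mul_le_mul_of_nonneg_left hvar (sq_nonneg c)
        linarith
    _ ≤ _ := Real.add_one_le_exp _

section Draws

variable {Ω : Type*} [MeasurableSpace Ω] {P : Measure Ω} [IsProbabilityMeasure P] {n m : ℕ}
  {π : Fin n → ℝ} {K : Fin m → Ω → Fin n}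

/-- One-sided Bernstein inequality for sums of `g (K ℓ)`. -/
theorem measureReal_sum_ge_le (hπ : ∀ k, 0 ≤ π k) (hπ1 : ∑ k, π k = 1)
    (hK : ∀ ℓ, Measurable (K ℓ)) (hind : iIndepFun K P)
    (hlaw : ∀ ℓ k, P {ω | K ℓ ω = k} = ENNReal.ofReal (π k)) {R : ℝ} (hR : 1 ≤ R)
    (g : Fin n → ℝ) (hbd : ∀ k, |g k| ≤ R) (hvar : ∑ k, π k * g k ^ 2 ≤ R) (T : Finset (Fin m)) :
    P.real {ω | (T.card : ℝ) * (∑ k, π k * g k) + T.card / 8 ≤ ∑ ℓ ∈ T, g (K ℓ ω)} ≤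
      Real.exp (-(T.card / (256 * R))) := by
  have hR0 : 0 < R := by linarith
  -- This `c` minimises `c² R - c / 8`, the Chernoff exponent per draw; the minimum is `-1 / (256
  -- R)`.
  set c : ℝ := 1 / (16 * R) with hc
  have hc0 : 0 ≤ c := by positivity
  have hcbd : ∀ k, |c * g k| ≤ 1 := by
    intro k
    rw [abs_mul, abs_of_nonneg hc0]
    calc c * |g k| ≤ c * R := mul_le_mul_of_nonneg_left (hbd k) hc0
      _ = 1 / 16 := by rw [hc]; field_simp
      _ ≤ 1 := by norm_num
  set X : Fin m → Ω → ℝ := fun ℓ => g ∘ K ℓ with hX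
  have hXm : ∀ ℓ, Measurable (X ℓ) := fun ℓ => Measurable.of_discrete.comp (hK ℓ)
  have hXi : iIndepFun X P := hind.comp (fun _ => g) fun _ => Measurable.of_discrete
  have hmgf : ∀ ℓ, mgf (X ℓ) P c ≤ Real.exp (c * ∑ k, π k * g k + c ^ 2 * R) := by
    intro ℓ
    have := integral_comp_eq_sum hπ (hK ℓ) (hlaw ℓ) (fun k => Real.exp (c * g k))
    unfold mgf
    simp only [hX, Function.comp_apply]
    rw [this]
    exact sum_mul_exp_le hπ hπ1 g hcbd hvar
  have hint : Integrable (fun ω => Real.exp (c * (∑ ℓ ∈ T, X ℓ) ω)) P := by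
    refine Integrable.of_bound (C := Real.exp T.card) ?_ ?_
    · refine (Real.measurable_exp.comp (Measurable.const_mul ?_ c)).aestronglyMeasurable
      convert Finset.measurable_sum T fun ℓ _ => hXm ℓ using 1
      ext ω
      simp
    · refine Filter.Eventually.of_forall fun ω => ?_
      rw [Real.norm_eq_abs, Real.abs_exp]
      refine Real.exp_le_exp.2 ?_
      rw [Finset.sum_apply, Finset.mul_sum]
      calc _ ≤ ∑ ℓ ∈ T, (1 : ℝ) :=
            Finset.sum_le_sum fun ℓ _ => (le_abs_self _).trans (hcbd (K ℓ ω))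
        _ = T.card := by simp
  have hmain := measure_ge_le_exp_mul_mgf (μ := P) (X := ∑ ℓ ∈ T, X ℓ) (t := c)
    ((T.card : ℝ) * (∑ k, π k * g k) + T.card / 8) hc0 hint
  have hset : {ω | (T.card : ℝ) * (∑ k, π k * g k) + T.card / 8 ≤ ∑ ℓ ∈ T, g (K ℓ ω)} =
      {ω | (T.card : ℝ) * (∑ k, π k * g k) + T.card / 8 ≤ (∑ ℓ ∈ T, X ℓ) ω} := by
    ext ω; simp [hX, Finset.sum_apply]
  rw [hset]
  refine hmain.trans ?_
  rw [hXi.mgf_sum hXm T]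
  calc _ ≤ Real.exp (-c * ((T.card : ℝ) * (∑ k, π k * g k) + T.card / 8)) *
        ∏ ℓ ∈ T, Real.exp (c * ∑ k, π k * g k + c ^ 2 * R) := by
        refine mul_le_mul_of_nonneg_left ?_ (Real.exp_nonneg _)
        exact Finset.prod_le_prod (fun ℓ _ => mgf_nonneg) fun ℓ _ => hmgf ℓ
    _ = Real.exp (-(T.card / (256 * R))) := by
        rw [Finset.prod_const, ← Real.exp_nat_mul, ← Real.exp_add]
        congr 1
        rw [hc]
        field_simp
        ring

/-- Two-sided Bernstein inequality for complex-valued functions of the draws. -/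
theorem measureReal_norm_sum_sub_gt_le (hπ : ∀ k, 0 ≤ π k) (hπ1 : ∑ k, π k = 1)
    (hK : ∀ ℓ, Measurable (K ℓ)) (hind : iIndepFun K P)
    (hlaw : ∀ ℓ k, P {ω | K ℓ ω = k} = ENNReal.ofReal (π k)) {R : ℝ} (hR : 1 ≤ R)
    (f : Fin n → ℂ) (hbd : ∀ k, ‖f k‖ ≤ R) (hvar : ∑ k, π k * ‖f k‖ ^ 2 ≤ R)
    (T : Finset (Fin m)) :
    P.real {ω | (T.card : ℝ) / 4 < ‖∑ ℓ ∈ T, f (K ℓ ω) - T.card * ∑ k, (π k : ℂ) * f k‖} ≤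
      4 * Real.exp (-(T.card / (256 * R))) := by
  have key : ∀ g : Fin n → ℝ, (∀ k, |g k| ≤ ‖f k‖) →
      P.real {ω | (T.card : ℝ) * (∑ k, π k * g k) + T.card / 8 ≤ ∑ ℓ ∈ T, g (K ℓ ω)} ≤
        Real.exp (-(T.card / (256 * R))) := by
    intro g hg
    refine measureReal_sum_ge_le hπ hπ1 hK hind hlaw hR g (fun k => (hg k).trans (hbd k)) ?_ T
    refine (Finset.sum_le_sum fun k _ => ?_).trans hvar
    refine mul_le_mul_of_nonneg_left ?_ (hπ k)
    rw [← sq_abs]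
    exact pow_le_pow_left₀ (abs_nonneg _) (hg k) 2
  have k1 := key (fun k => (f k).re) fun k => Complex.abs_re_le_norm _
  have k2 := key (fun k => -(f k).re) fun k => by rw [abs_neg]; exact Complex.abs_re_le_norm _
  have k3 := key (fun k => (f k).im) fun k => Complex.abs_im_le_norm _
  have k4 := key (fun k => -(f k).im) fun k => by rw [abs_neg]; exact Complex.abs_im_le_norm _
  set A1 := {ω | (T.card : ℝ) * (∑ k, π k * (f k).re) + T.card / 8 ≤ ∑ ℓ ∈ T, (f (K ℓ ω)).re}
  set A2 := {ω | (T.card : ℝ) * (∑ k, π k * -(f k).re) + T.card / 8 ≤ ∑ ℓ ∈ T, -(f (K ℓ ω)).re}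
  set A3 := {ω | (T.card : ℝ) * (∑ k, π k * (f k).im) + T.card / 8 ≤ ∑ ℓ ∈ T, (f (K ℓ ω)).im}
  set A4 := {ω | (T.card : ℝ) * (∑ k, π k * -(f k).im) + T.card / 8 ≤ ∑ ℓ ∈ T, -(f (K ℓ ω)).im}
  -- Off the four one-sided events the real and imaginary parts each deviate by at most `|T| / 8`.
  have hsub : {ω | (T.card : ℝ) / 4 < ‖∑ ℓ ∈ T, f (K ℓ ω) - T.card * ∑ k, (π k : ℂ) * f k‖} ⊆
      (A1 ∪ A2) ∪ (A3 ∪ A4) := by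
    intro ω hω
    by_contra hno
    simp only [Set.mem_union, not_or, A1, A2, A3, A4, Set.mem_ofPred_eq, not_le, mul_neg,
      Finset.sum_neg_distrib] at hno
    obtain ⟨⟨h1, h2⟩, h3, h4⟩ := hno
    have hre : (∑ ℓ ∈ T, f (K ℓ ω) - T.card * ∑ k, (π k : ℂ) * f k).re =
        ∑ ℓ ∈ T, (f (K ℓ ω)).re - T.card * ∑ k, π k * (f k).re := by
      simp [Complex.re_sum]
    have him : (∑ ℓ ∈ T, f (K ℓ ω) - T.card * ∑ k, (π k : ℂ) * f k).im =
        ∑ ℓ ∈ T, (f (K ℓ ω)).im - T.card * ∑ k, π k * (f k).im := by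
      simp [Complex.im_sum]
    have hn := Complex.norm_le_abs_re_add_abs_im
      (∑ ℓ ∈ T, f (K ℓ ω) - T.card * ∑ k, (π k : ℂ) * f k)
    rw [hre, him] at hn
    have hr : |∑ ℓ ∈ T, (f (K ℓ ω)).re - T.card * ∑ k, π k * (f k).re| ≤ (T.card : ℝ) / 8 :=
      abs_le.2 ⟨by linarith, by linarith⟩
    have hi : |∑ ℓ ∈ T, (f (K ℓ ω)).im - T.card * ∑ k, π k * (f k).im| ≤ (T.card : ℝ) / 8 :=
      abs_le.2 ⟨by linarith, by linarith⟩
    rw [Set.mem_ofPred_eq] at hω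
    linarith
  have hu := measureReal_mono (μ := P) hsub
  have u1 := measureReal_union_le (μ := P) (A1 ∪ A2) (A3 ∪ A4)
  have u2 := measureReal_union_le (μ := P) A1 A2
  have u3 := measureReal_union_le (μ := P) A3 A4
  linarith

end Draws

/-! ### The normalised golfing iteration -/

section Golfing

variable {n m : ℕ} (A : Matrix (Fin n) (Fin n) ℂ) (π : Fin n → ℝ) (S : Finset (Fin n))

/-- The `i`-th coordinate of `π_k⁻¹ a_k a_k^* v`. -/
noncomputable def sample (v : Fin n → ℂ) (k i : Fin n) : ℂ :=
  ((π k)⁻¹ : ℝ) * (star (A k i) * A.mulVec v k)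

/-- The error of the empirical mean of `π_k⁻¹ a_k a_k^* v` over the draws in `T`. -/
noncomputable def empError (v : Fin n → ℂ) (k : Fin m → Fin n) (T : Finset (Fin m)) (i : Fin n) :
    ℂ :=
  v i - (T.card : ℂ)⁻¹ * ∑ ℓ ∈ T, sample A π v (k ℓ) i

/-- The golfing iterates, each rescaled to have sup norm at most `1`. -/
noncomputable def golf (B : ℕ → Finset (Fin m)) (v : Fin n → ℂ) (k : Fin m → Fin n) :
    ℕ → Fin n → ℂ
  | 0 => v
  | t + 1 => restrict S fun i => 4 * empError A π (golf B v k t) k (B t) i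

variable {A π S}

theorem golf_eq_zero_of_notMem {B : ℕ → Finset (Fin m)} {v : Fin n → ℂ} {k : Fin m → Fin n}
    (hv : ∀ j ∉ S, v j = 0) (t : ℕ) : ∀ j ∉ S, golf A π S B v k t j = 0 := by
  intro j hj
  cases t with
  | zero => exact hv j hj
  | succ t => simp [golf, restrict, hj]

theorem empError_congr {v : Fin n → ℂ} {k k' : Fin m → Fin n} {T : Finset (Fin m)}
    (h : ∀ ℓ ∈ T, k ℓ = k' ℓ) : empError A π v k T = empError A π v k' T := by
  ext i
  unfold empError
  rw [Finset.sum_congr rfl fun ℓ hℓ => by rw [h ℓ hℓ]]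

theorem golf_congr {B : ℕ → Finset (Fin m)} {v : Fin n → ℂ} {k k' : Fin m → Fin n} (t : ℕ)
    (h : ∀ ℓ ∈ (Finset.range t).biUnion B, k ℓ = k' ℓ) :
    golf A π S B v k t = golf A π S B v k' t := by
  induction t with
  | zero => rfl
  | succ t ih =>
    have h1 : golf A π S B v k t = golf A π S B v k' t := by
      refine ih fun ℓ hℓ => h ℓ ?_
      rw [Finset.range_add_one, Finset.biUnion_insert]
      exact Finset.mem_union_right _ hℓ
    have h2 : ∀ ℓ ∈ B t, k ℓ = k' ℓ := fun ℓ hℓ => h ℓ (by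
      rw [Finset.range_add_one, Finset.biUnion_insert]
      exact Finset.mem_union_left _ hℓ)
    simp only [golf, h1, empError_congr h2]

/-- The operator `π_k⁻¹ a_k a_k^*` is Hermitian, so it can be moved onto `h`, where the measurement
vanishes if `h` is in the kernel. -/
theorem star_sample_dotProduct (v h : Fin n → ℂ) (k : Fin n) :
    ∑ i, star (sample A π v k i) * h i =
      star (A.mulVec v k) * (((π k)⁻¹ : ℝ) * A.mulVec h k) := by
  have hsum : A.mulVec h k = ∑ i, A k i * h i := rfl
  rw [hsum, Finset.mul_sum, Finset.mul_sum]
  refine Finset.sum_congr rfl fun i _ => ?_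
  simp only [sample, star_mul', Complex.star_def, Complex.conj_ofReal, Complex.conj_conj]
  ring

theorem star_empError_dotProduct {v h : Fin n → ℂ} {k : Fin m → Fin n} (T : Finset (Fin m))
    (hh : ∀ ℓ, (((π (k ℓ))⁻¹ : ℝ) : ℂ) * A.mulVec h (k ℓ) = 0) :
    ∑ i, star (empError A π v k T i) * h i = ∑ i, star (v i) * h i := by
  have h0 : ∑ i, star (∑ ℓ ∈ T, sample A π v (k ℓ) i) * h i = 0 := by
    simp only [star_sum, Finset.sum_mul]
    rw [Finset.sum_comm]
    exact Finset.sum_eq_zero fun ℓ _ => by rw [star_sample_dotProduct, hh, mul_zero]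
  have : ∀ i, star (empError A π v k T i) * h i = star (v i) * h i -
      star ((T.card : ℂ)⁻¹) * (star (∑ ℓ ∈ T, sample A π v (k ℓ) i) * h i) := by
    intro i
    simp only [empError, star_sub, star_mul']
    ring
  simp only [this, Finset.sum_sub_distrib, ← Finset.mul_sum, h0, mul_zero, sub_zero]

/-- One golfing step: `v` may be replaced by its sampling error when paired with `h`. On `S` that
error is a quarter of the next iterate; off `S` the uniform bound is paid once and for all. -/
theorem norm_star_dotProduct_le_of_empError {v h : Fin n → ℂ} {k : Fin m → Fin n}
    {T : Finset (Fin m)} (hh : ∀ ℓ, (((π (k ℓ))⁻¹ : ℝ) : ℂ) * A.mulVec h (k ℓ) = 0)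
    (hgood : ∀ i, ‖empError A π v k T i‖ ≤ 1 / 4) :
    ‖∑ i, star (v i) * h i‖ ≤
      1 / 4 * ‖∑ i, star (restrict S (fun i => 4 * empError A π v k T i) i) * h i‖ +
        1 / 4 * ∑ j ∈ Sᶜ, ‖h j‖ := by
  rw [← star_empError_dotProduct T hh, ← Finset.sum_add_sum_compl S]
  refine (norm_add_le _ _).trans (add_le_add (le_of_eq ?_) ?_)
  · have : ∑ i, star (restrict S (fun i => 4 * empError A π v k T i) i) * h i =
        4 * ∑ i ∈ S, star (empError A π v k T i) * h i := by
      rw [← Finset.sum_add_sum_compl S, Finset.mul_sum]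
      have h0 : ∑ i ∈ Sᶜ, star (restrict S (fun i => 4 * empError A π v k T i) i) * h i = 0 := by
        refine Finset.sum_eq_zero fun i hi => ?_
        simp [restrict, Finset.mem_compl.1 hi]
      rw [h0, add_zero]
      refine Finset.sum_congr rfl fun i hi => ?_
      simp only [restrict, hi, if_true, star_mul']
      rw [mul_assoc]
      simp
    rw [this, norm_mul]
    norm_num
    ring
  · rw [Finset.mul_sum]
    refine (norm_sum_le _ _).trans (Finset.sum_le_sum fun i _ => ?_)
    rw [norm_mul, norm_star]
    exact mul_le_mul_of_nonneg_right (hgood i) (norm_nonneg _)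

theorem norm_restrict_four_mul_le {e : Fin n → ℂ} (he : ∀ i, ‖e i‖ ≤ 1 / 4) :
    ‖restrict S fun i => 4 * e i‖ ≤ 1 := by
  rw [pi_norm_le_iff_of_nonneg zero_le_one]
  intro i
  unfold restrict
  split_ifs
  · rw [norm_mul]
    have := he i
    norm_num
    linarith
  · simp

/-- The failure event of one golfing step at one coordinate. -/
def golfFailure (A : Matrix (Fin n) (Fin n) ℂ) (π : Fin n → ℝ) (S : Finset (Fin n))
    (B : ℕ → Finset (Fin m)) (v : Fin n → ℂ) (t : ℕ) (i : Fin n) : Set (Fin m → Fin n) :=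
  {k | ‖golf A π S B v k t‖ ≤ 1 ∧ 1 / 4 < ‖empError A π (golf A π S B v k t) k (B t) i‖}

/-- A failure is charged only while the iterate is in the unit ball, where Bernstein's hypotheses
hold. Induction shows that the iterate never leaves the ball without an earlier failure. -/
theorem norm_golf_le_one {B : ℕ → Finset (Fin m)} {v : Fin n → ℂ} {k : Fin m → Fin n} {L : ℕ}
    (hv : ‖v‖ ≤ 1) (hgood : ∀ t < L, ∀ i, k ∉ golfFailure A π S B v t i) :
    ∀ t ≤ L, ‖golf A π S B v k t‖ ≤ 1 := by
  intro t
  induction t with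
  | zero => exact fun _ => hv
  | succ t ih =>
    intro ht
    refine norm_restrict_four_mul_le fun i => ?_
    by_contra hlt
    exact hgood t ht i ⟨ih (Nat.le_of_succ_le ht), not_le.1 hlt⟩

/-- Off the failure events, every vector `h` in the kernel of the sensing matrix almost
annihilates `v`. -/
theorem norm_star_dotProduct_le {B : ℕ → Finset (Fin m)} {v h : Fin n → ℂ} {k : Fin m → Fin n}
    {L : ℕ} (hv : ‖v‖ ≤ 1) (hvS : ∀ j ∉ S, v j = 0)
    (hgood : ∀ t < L, ∀ i, k ∉ golfFailure A π S B v t i)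
    (hh : ∀ ℓ, (((π (k ℓ))⁻¹ : ℝ) : ℂ) * A.mulVec h (k ℓ) = 0) :
    ‖∑ i, star (v i) * h i‖ ≤ (1 / 4) ^ L * ∑ j ∈ S, ‖h j‖ + 1 / 3 * ∑ j ∈ Sᶜ, ‖h j‖ := by
  have hnorm := norm_golf_le_one hv hgood
  have hb : 0 ≤ ∑ j ∈ Sᶜ, ‖h j‖ := Finset.sum_nonneg fun _ _ => norm_nonneg _
  -- The second coefficient is the partial geometric sum `1/4 + ⋯ + 1/4^t`.
  have key : ∀ t ≤ L, ‖∑ i, star (v i) * h i‖ ≤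
      (1 / 4) ^ t * ‖∑ i, star (golf A π S B v k t i) * h i‖ +
        1 / 3 * (1 - (1 / 4) ^ t) * ∑ j ∈ Sᶜ, ‖h j‖ := by
    intro t
    induction t with
    | zero => intro _; simp [golf]
    | succ t ih =>
      intro ht
      have hstep := norm_star_dotProduct_le_of_empError (S := S) (T := B t) (v := golf A π S B v k t)
        hh fun i => by
          by_contra hlt
          exact hgood t ht i ⟨hnorm t (Nat.le_of_succ_le ht), not_le.1 hlt⟩
      refine (ih (Nat.le_of_succ_le ht)).trans ?_
      have := mul_le_mul_of_nonneg_left hstep (by positivity : (0 : ℝ) ≤ (1 / 4) ^ t)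
      simp only [golf]
      rw [pow_succ]
      linarith
  have hlast : ‖∑ i, star (golf A π S B v k L i) * h i‖ ≤ ∑ j ∈ S, ‖h j‖ := by
    rw [← Finset.sum_add_sum_compl S]
    have h0 : ∑ i ∈ Sᶜ, star (golf A π S B v k L i) * h i = 0 :=
      Finset.sum_eq_zero fun i hi => by
        rw [golf_eq_zero_of_notMem hvS L i (Finset.mem_compl.1 hi), star_zero, zero_mul]
    rw [h0, add_zero]
    refine (norm_sum_le _ _).trans (Finset.sum_le_sum fun i _ => ?_)
    rw [norm_mul, norm_star]
    exact mul_le_of_le_one_left (norm_nonneg _) ((norm_le_pi_norm _ i).trans (hnorm L le_rfl))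
  refine (key L le_rfl).trans (add_le_add ?_ ?_)
  · exact mul_le_mul_of_nonneg_left hlast (by positivity)
  · refine mul_le_mul_of_nonneg_right ?_ hb
    have : (0 : ℝ) ≤ (1 / 4) ^ L := by positivity
    linarith

/-- The probability of a single golfing failure. -/
theorem measureReal_golfFailure_le {Ω : Type*} [MeasurableSpace Ω] {P : Measure Ω}
    [IsProbabilityMeasure P] {K : Fin m → Ω → Fin n}
    (hπ : ∀ k, 0 ≤ π k) (hπ1 : ∑ k, π k = 1)
    (hK : ∀ ℓ, Measurable (K ℓ)) (hind : iIndepFun K P)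
    (hlaw : ∀ ℓ k, P {ω | K ℓ ω = k} = ENNReal.ofReal (π k)) {R : ℝ} (hR : 1 ≤ R)
    (hbd : ∀ v : Fin n → ℂ, (∀ j ∉ S, v j = 0) → ‖v‖ ≤ 1 → ∀ k i, ‖sample A π v k i‖ ≤ R)
    (hvar : ∀ v : Fin n → ℂ, (∀ j ∉ S, v j = 0) → ‖v‖ ≤ 1 →
      ∀ i, ∑ k, π k * ‖sample A π v k i‖ ^ 2 ≤ R)
    (hmean : ∀ v : Fin n → ℂ, (∀ j ∉ S, v j = 0) →
      ∀ i, ∑ k, (π k : ℂ) * sample A π v k i = v i)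
    {B : ℕ → Finset (Fin m)} {q t : ℕ} (hq : 0 < q) (hcard : (B t).card = q)
    (hdisj : ∀ t' < t, Disjoint (B t') (B t)) (k₀ : Fin n)
    {v : Fin n → ℂ} (hvS : ∀ j ∉ S, v j = 0) (i : Fin n) :
    P.real {ω | (fun ℓ => K ℓ ω) ∈ golfFailure A π S B v t i} ≤
      4 * Real.exp (-(q / (256 * R))) := by
  classical
  -- The iterate at time `t` depends only on the draws in `T`, which are independent of batch `t`;
  -- it can therefore be frozen.
  set T := (Finset.range t).biUnion B with hT
  have hTd : Disjoint T (B t) := by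
    rw [hT, Finset.disjoint_biUnion_left]
    exact fun t' ht' => hdisj t' (Finset.mem_range.1 ht')
  have hXY := hind.indepFun_finset T (B t) hTd hK
  set X : Ω → (T → Fin n) := fun ω ℓ => K ℓ ω
  set Y : Ω → (B t → Fin n) := fun ω ℓ => K ℓ ω
  -- The filler `k₀` is immaterial, since only the draws in `U` are read.
  set ext : ∀ U : Finset (Fin m), (U → Fin n) → Fin m → Fin n :=
    fun U y ℓ => if hℓ : ℓ ∈ U then y ⟨ℓ, hℓ⟩ else k₀ with hext
  have hX : Measurable X := measurable_pi_lambda _ fun ℓ => hK ℓ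
  set E : (T → Fin n) → Set (B t → Fin n) := fun y =>
    {z | ‖golf A π S B v (ext T y) t‖ ≤ 1 ∧
      1 / 4 < ‖empError A π (golf A π S B v (ext T y) t) (ext (B t) z) (B t) i‖}
  have hset : {ω | (fun ℓ => K ℓ ω) ∈ golfFailure A π S B v t i} = {ω | Y ω ∈ E (X ω)} := by
    ext ω
    have h1 : golf A π S B v (fun ℓ => K ℓ ω) t = golf A π S B v (ext T (X ω)) t :=
      golf_congr t fun ℓ hℓ => by simp only [hext]; rw [dif_pos hℓ]
    have h2 : ∀ w, empError A π w (fun ℓ => K ℓ ω) (B t) =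
        empError A π w (ext (B t) (Y ω)) (B t) := fun w =>
      empError_congr fun ℓ hℓ => by simp only [hext]; rw [dif_pos hℓ]
    change (_ ∧ _) ↔ (_ ∧ _)
    rw [h1, h2]
  rw [hset]
  refine measureReal_section_le_of_indepFun hX hXY E fun y => ?_
  set w := golf A π S B v (ext T y) t with hw
  have hwS : ∀ j ∉ S, w j = 0 := golf_eq_zero_of_notMem hvS t
  by_cases hw1 : ‖w‖ ≤ 1
  swap
  · have : {ω | Y ω ∈ E y} = ∅ := by
      ext ω
      simp only [Set.mem_empty_iff_false, iff_false]
      exact fun hω => hw1 hω.1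
    rw [this, measureReal_empty]
    positivity
  have hq0 : (0 : ℝ) < q := by exact_mod_cast hq
  have hbern := measureReal_norm_sum_sub_gt_le hπ hπ1 hK hind hlaw hR
    (fun k => sample A π w k i) (fun k => hbd w hwS hw1 k i) (hvar w hwS hw1 i) (B t)
  rw [hcard, hmean w hwS i] at hbern
  refine (measureReal_mono ?_).trans hbern
  rintro ω ⟨-, hω⟩
  have h2 : empError A π w (ext (B t) (Y ω)) (B t) = empError A π w (fun ℓ => K ℓ ω) (B t) :=
    empError_congr fun ℓ hℓ => by simp only [hext]; rw [dif_pos hℓ]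
  rw [← hw, h2] at hω
  have h3 : ∑ ℓ ∈ B t, sample A π w (K ℓ ω) i - q * w i =
      -(q * empError A π w (fun ℓ => K ℓ ω) (B t) i) := by
    have : (q : ℂ) ≠ 0 := by exact_mod_cast hq.ne'
    unfold empError
    rw [hcard]
    field_simp
    ring
  rw [Set.mem_ofPred_eq, h3, norm_neg, norm_mul, Complex.norm_natCast]
  nlinarith

/-- Disjoint batches of a common size. -/
theorem exists_batches {L q : ℕ} (hLq : L * q ≤ m) : ∃ B : ℕ → Finset (Fin m),
    (∀ t < L, (B t).card = q) ∧ ∀ t' t, t' < t → Disjoint (B t') (B t) := by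
  refine ⟨fun t => Finset.univ.filter fun ℓ => t * q ≤ (ℓ : ℕ) ∧ (ℓ : ℕ) < (t + 1) * q, ?_, ?_⟩
  · intro t ht
    have : (Finset.univ.filter fun ℓ : Fin m => t * q ≤ (ℓ : ℕ) ∧ (ℓ : ℕ) < (t + 1) * q).map
        Fin.valEmbedding = Finset.Ico (t * q) ((t + 1) * q) := by
      ext a
      simp only [Finset.mem_map, Finset.mem_filter, Finset.mem_univ, true_and,
        Fin.valEmbedding_apply, Finset.mem_Ico]
      constructor
      · rintro ⟨ℓ, h, rfl⟩
        exact h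
      · intro h
        exact ⟨⟨a, h.2.trans_le ((Nat.mul_le_mul_right q ht).trans hLq)⟩, h, rfl⟩
    rw [← Finset.card_map, this, Nat.card_Ico, Nat.succ_mul, Nat.add_sub_cancel_left]
  · intro t' t ht
    rw [Finset.disjoint_left]
    intro ℓ h1 h2
    simp only [Finset.mem_filter] at h1 h2
    have := Nat.mul_le_mul_right q (show t' + 1 ≤ t from ht)
    omega

end Golfing

/-! ### Deterministic recovery -/

/-- The subgradient inequality for the modulus. At `z = 0` the convention `0 / 0 = 0` selects the
subgradient `0`. -/
theorem norm_add_re_le_norm_add (z w : ℂ) : ‖z‖ + (star (z / ‖z‖) * w).re ≤ ‖z + w‖ := by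
  by_cases hz : z = 0
  · simp [hz]
  have hz' : (‖z‖ : ℂ) ≠ 0 := by simpa using hz
  have h1 : star (z / ‖z‖) * z = ‖z‖ := by
    rw [Complex.star_def, map_div₀, Complex.conj_ofReal, div_mul_eq_mul_div, Complex.conj_mul',
      sq, mul_div_assoc, div_self hz', mul_one]
  have h2 : ‖star (z / ‖z‖)‖ = 1 := by
    rw [norm_star, norm_div, Complex.norm_real, norm_norm, div_self (by simpa using hz)]
  calc ‖z‖ + (star (z / ‖z‖) * w).re = (star (z / ‖z‖) * (z + w)).re := by
        rw [mul_add, h1, Complex.add_re, Complex.ofReal_re]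
    _ ≤ ‖star (z / ‖z‖) * (z + w)‖ := Complex.re_le_norm _
    _ = ‖z + w‖ := by rw [norm_mul, h2, one_mul]

/-- Let `a`, `b` be the `ℓ¹` masses of `h` on and off `S`. Summing `hcoord` over `S` gives `a ≤ a/4
+ |S| b/3`, so `a ≤ (4/9) |S| b` and `η a ≤ b/9`. The sign pairing is then at most `(1/9 + 1/3) b`,
which is less than `b` because `h ≠ 0` forces `b > 0`. -/
theorem l1Norm_lt_of_certificates {n : ℕ} {S : Finset (Fin n)} {x h : Fin n → ℂ} {η : ℝ}
    (hx : ∀ j ∉ S, x j = 0) (hh : h ≠ 0) (hη : 4 * S.card * η ≤ 1) (hη0 : 0 ≤ η)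
    (hS : 0 < S.card)
    (hsgn : ‖∑ i, star (x i / ‖x i‖) * h i‖ ≤ η * ∑ j ∈ S, ‖h j‖ + 1 / 3 * ∑ j ∈ Sᶜ, ‖h j‖)
    (hcoord : ∀ j ∈ S, ‖h j‖ ≤ η * ∑ j ∈ S, ‖h j‖ + 1 / 3 * ∑ j ∈ Sᶜ, ‖h j‖) :
    l1Norm x < l1Norm (x + h) := by
  set a := ∑ j ∈ S, ‖h j‖ with ha
  set b := ∑ j ∈ Sᶜ, ‖h j‖ with hb
  have ha0 : 0 ≤ a := Finset.sum_nonneg fun _ _ => norm_nonneg _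
  have hb0 : 0 ≤ b := Finset.sum_nonneg fun _ _ => norm_nonneg _
  have hs : (0 : ℝ) < S.card := by exact_mod_cast hS
  have h1 : a ≤ S.card * (η * a + 1 / 3 * b) := by
    rw [ha, ← nsmul_eq_mul]
    exact Finset.sum_le_card_nsmul _ _ _ hcoord
  have h2 : a ≤ 4 / 9 * (S.card * b) := by
    have := mul_le_mul_of_nonneg_right hη ha0
    linarith
  have h3 : η * a ≤ b / 9 := by
    have h4 := mul_le_mul_of_nonneg_left h2 hη0
    have h5 := mul_le_mul_of_nonneg_right hη hb0
    linarith
  have hbpos : 0 < b := by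
    refine lt_of_le_of_ne hb0 fun hb' => hh ?_
    have ha' : a = 0 := le_antisymm (by rw [← hb'] at h2; simpa using h2) ha0
    ext j
    by_cases hj : j ∈ S
    · exact norm_eq_zero.1 ((Finset.sum_eq_zero_iff_of_nonneg fun _ _ => norm_nonneg _).1 ha' j hj)
    · exact norm_eq_zero.1 ((Finset.sum_eq_zero_iff_of_nonneg fun _ _ => norm_nonneg _).1
        hb'.symm j (Finset.mem_compl.2 hj))
  have hxS : l1Norm x = ∑ j ∈ S, ‖x j‖ := by
    unfold l1Norm
    rw [← Finset.sum_add_sum_compl S, Finset.sum_eq_zero (s := Sᶜ), add_zero]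
    exact fun j hj => by rw [hx j (Finset.mem_compl.1 hj), norm_zero]
  have hpair : ∑ i, star (x i / ‖x i‖) * h i = ∑ i ∈ S, star (x i / ‖x i‖) * h i := by
    rw [← Finset.sum_add_sum_compl S, Finset.sum_eq_zero (s := Sᶜ), add_zero]
    exact fun j hj => by simp [hx j (Finset.mem_compl.1 hj)]
  have hxh : l1Norm (x + h) = ∑ j ∈ S, ‖x j + h j‖ + b := by
    unfold l1Norm
    rw [← Finset.sum_add_sum_compl S, hb]
    congr 1
    exact Finset.sum_congr rfl fun j hj => by
      rw [Pi.add_apply, hx j (Finset.mem_compl.1 hj), zero_add]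
  have hre : ∑ j ∈ S, ‖x j‖ + (∑ i ∈ S, star (x i / ‖x i‖) * h i).re ≤ ∑ j ∈ S, ‖x j + h j‖ := by
    rw [Complex.re_sum, ← Finset.sum_add_distrib]
    exact Finset.sum_le_sum fun j _ => norm_add_re_le_norm_add _ _
  have habs := (abs_le.1 (Complex.abs_re_le_norm (∑ i ∈ S, star (x i / ‖x i‖) * h i))).1
  rw [hpair] at hsgn
  rw [hxS, hxh]
  linarith

/-! ### Consequences of the two conditions -/

section Conditions

variable {n : ℕ} {A : Matrix (Fin n) (Fin n) ℂ} {π : Fin n → ℝ} {S : Finset (Fin n)}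

theorem norm_mulVec_le_sum_mul {v : Fin n → ℂ} (hv : ∀ j ∉ S, v j = 0) (k : Fin n) :
    ‖A.mulVec v k‖ ≤ (∑ j ∈ S, ‖A k j‖) * ‖v‖ := by
  have : A.mulVec v k = ∑ j ∈ S, A k j * v j := by
    unfold Matrix.mulVec dotProduct
    rw [← Finset.sum_add_sum_compl S, Finset.sum_eq_zero (s := Sᶜ), add_zero]
    exact fun j hj => by rw [hv j (Finset.mem_compl.1 hj), mul_zero]
  rw [this, Finset.sum_mul]
  refine (norm_sum_le _ _).trans (Finset.sum_le_sum fun j _ => ?_)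
  rw [norm_mul]
  exact mul_le_mul_of_nonneg_left (norm_le_pi_norm v j) (norm_nonneg _)

theorem norm_entry_le_norm_rowVec (k i : Fin n) : ‖A k i‖ ≤ ‖rowVec A k‖ := by
  have := norm_le_pi_norm (rowVec A k) i
  simpa [rowVec] using this

/-- The level structure enters only here, by bounding the entries of `S ∩ Lev ℓ` by their maximum
over the level. -/
theorem sum_norm_le_sum_levels {N : ℕ} {Lev : Fin N → Finset (Fin n)}
    (hdisj : Pairwise fun i j => Disjoint (Lev i) (Lev j)) (hcov : ∀ j, ∃ i, j ∈ Lev i)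
    {sLev : Fin N → ℕ} (hsLev : ∀ i, (S ∩ Lev i).card = sLev i) (k : Fin n) :
    ∑ j ∈ S, ‖A k j‖ ≤ ∑ ℓ, (sLev ℓ : ℝ) * ‖restrict (Lev ℓ) (rowVec A k)‖ := by
  classical
  have hS : S = Finset.univ.biUnion fun ℓ => S ∩ Lev ℓ := by
    ext j
    simp only [Finset.mem_biUnion, Finset.mem_univ, true_and, Finset.mem_inter]
    exact ⟨fun hj => (hcov j).imp fun i hi => ⟨hj, hi⟩, fun ⟨_, h⟩ => h.1⟩
  conv_lhs => rw [hS]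
  rw [Finset.sum_biUnion fun a _ b _ hab => (hdisj hab).mono Finset.inter_subset_right
    Finset.inter_subset_right]
  refine Finset.sum_le_sum fun ℓ _ => ?_
  rw [← hsLev ℓ, ← nsmul_eq_mul]
  refine Finset.sum_le_card_nsmul _ _ _ fun j hj => ?_
  have := norm_le_pi_norm (restrict (Lev ℓ) (rowVec A k)) j
  simpa [restrict, rowVec, (Finset.mem_inter.1 hj).2] using this

theorem sum_norm_mul_le_of_levelCoherence_le (hπ : ∀ k, 0 ≤ π k) {N : ℕ}
    {Lev : Fin N → Finset (Fin n)}
    (hdisj : Pairwise fun i j => Disjoint (Lev i) (Lev j)) (hcov : ∀ j, ∃ i, j ∈ Lev i)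
    {sLev : Fin N → ℕ} (hsLev : ∀ i, (S ∩ Lev i).card = sLev i) {R : ℝ} (hR : 0 ≤ R)
    (hcoh : levelCoherence A π Lev sLev ≤ ENNReal.ofReal R) (k : Fin n) :
    (∑ j ∈ S, ‖A k j‖) * ‖rowVec A k‖ ≤ R * π k := by
  have h1 : (∑ j ∈ S, ‖A k j‖) * ‖rowVec A k‖ ≤
      ∑ ℓ, (sLev ℓ : ℝ) * ‖restrict (Lev ℓ) (rowVec A k)‖ * ‖rowVec A k‖ := by
    rw [← Finset.sum_mul]
    exact mul_le_mul_of_nonneg_right (sum_norm_le_sum_levels hdisj hcov hsLev k) (norm_nonneg _)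
  refine h1.trans ?_
  have h2 := (le_iSup (fun k : Fin n => ENNReal.ofReal
    (∑ ℓ, (sLev ℓ : ℝ) * ‖restrict (Lev ℓ) (rowVec A k)‖ * ‖rowVec A k‖) /
      ENNReal.ofReal (π k)) k).trans hcoh
  -- At zero weight, finiteness of the coherence forces the numerator to vanish, so the inequality
  -- survives clearing the denominator.
  rcases (hπ k).eq_or_lt with h0 | h0
  · rw [← h0, mul_zero]
    by_contra hlt
    rw [← h0, ENNReal.ofReal_zero, ENNReal.div_zero (by simpa using hlt)] at h2
    exact ENNReal.ofReal_ne_top (top_le_iff.1 h2)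
  · rw [ENNReal.div_le_iff_le_mul (Or.inl (by simpa using h0)) (Or.inl ENNReal.ofReal_ne_top),
      ← ENNReal.ofReal_mul hR] at h2
    exact (ENNReal.ofReal_le_ofReal_iff (mul_nonneg hR (hπ k))).1 h2

theorem conjTranspose_mulVec_mulVec (hA : A ∈ Matrix.unitaryGroup (Fin n) ℂ) (v : Fin n → ℂ)
    (i : Fin n) : ∑ k, star (A k i) * A.mulVec v k = v i := by
  have h : (star A).mulVec (A.mulVec v) = v := by
    rw [Matrix.mulVec_mulVec, Matrix.mem_unitaryGroup_iff'.1 hA, Matrix.one_mulVec]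
  exact congrFun h i

theorem norm_rowVec_pos (hA : A ∈ Matrix.unitaryGroup (Fin n) ℂ) (k : Fin n) :
    0 < ‖rowVec A k‖ := by
  rw [norm_pos_iff]
  intro h0
  have h1 : (A * star A) k k = 1 := by rw [Matrix.mem_unitaryGroup_iff.1 hA, Matrix.one_apply_eq]
  have h2 : ∀ j, A k j = 0 := fun j => by simpa [rowVec] using congrFun h0 j
  rw [Matrix.mul_apply] at h1
  simp [h2] at h1

/-- A row of a unitary matrix is nonzero, so at zero weight the coherence bound makes it vanish on
`S`. Rows that are never drawn thus cause no bias. -/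
theorem mulVec_eq_zero_of_weight_eq_zero (hA : A ∈ Matrix.unitaryGroup (Fin n) ℂ) {R : ℝ}
    (hcoh : ∀ k, (∑ j ∈ S, ‖A k j‖) * ‖rowVec A k‖ ≤ R * π k) {v : Fin n → ℂ}
    (hv : ∀ j ∉ S, v j = 0) {k : Fin n} (hk : π k = 0) : A.mulVec v k = 0 := by
  have h1 := hcoh k
  rw [hk, mul_zero] at h1
  have h2 : ∑ j ∈ S, ‖A k j‖ ≤ 0 := nonpos_of_mul_nonpos_left h1 (norm_rowVec_pos hA k)
  have h3 := (norm_mulVec_le_sum_mul (A := A) hv k).trans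
    (mul_le_mul_of_nonneg_right h2 (norm_nonneg v))
  rw [zero_mul] at h3
  exact norm_le_zero_iff.1 h3

theorem norm_sample (hπ : ∀ k, 0 ≤ π k) (v : Fin n → ℂ) (k i : Fin n) :
    ‖sample A π v k i‖ = (π k)⁻¹ * (‖A k i‖ * ‖A.mulVec v k‖) := by
  rw [sample, norm_mul, norm_mul, norm_star, Complex.norm_real, Real.norm_eq_abs,
    abs_of_nonneg (inv_nonneg.2 (hπ k))]

theorem norm_sample_le (hπ : ∀ k, 0 ≤ π k) {R : ℝ} (hR : 0 ≤ R)
    (hcoh : ∀ k, (∑ j ∈ S, ‖A k j‖) * ‖rowVec A k‖ ≤ R * π k) {v : Fin n → ℂ}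
    (hv : ∀ j ∉ S, v j = 0) (hv1 : ‖v‖ ≤ 1) (k i : Fin n) : ‖sample A π v k i‖ ≤ R := by
  rw [norm_sample hπ]
  rcases (hπ k).eq_or_lt with h0 | h0
  · rw [← h0, inv_zero, zero_mul]
    exact hR
  have hD : 0 ≤ ∑ j ∈ S, ‖A k j‖ := Finset.sum_nonneg fun _ _ => norm_nonneg _
  rw [inv_mul_le_iff₀ h0, mul_comm (π k)]
  refine le_trans ?_ (hcoh k)
  rw [mul_comm]
  refine mul_le_mul ?_ (norm_entry_le_norm_rowVec k i) (norm_nonneg _) hD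
  exact (norm_mulVec_le_sum_mul hv k).trans (mul_le_of_le_one_right hD hv1)

theorem sum_mul_sample (hA : A ∈ Matrix.unitaryGroup (Fin n) ℂ) {R : ℝ}
    (hcoh : ∀ k, (∑ j ∈ S, ‖A k j‖) * ‖rowVec A k‖ ≤ R * π k) {v : Fin n → ℂ}
    (hv : ∀ j ∉ S, v j = 0) (i : Fin n) : ∑ k, (π k : ℂ) * sample A π v k i = v i := by
  rw [← conjTranspose_mulVec_mulVec hA v i]
  refine Finset.sum_congr rfl fun k _ => ?_
  by_cases hk : π k = 0
  · simp [sample, mulVec_eq_zero_of_weight_eq_zero hA hcoh hv hk]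
  · have : (π k : ℂ) ≠ 0 := by exact_mod_cast hk
    rw [sample, Complex.ofReal_inv, mul_inv_cancel_left₀ this]

theorem sum_mul_norm_sample_sq_le (hπ : ∀ k, 0 ≤ π k) {R : ℝ} (hR : 0 ≤ R)
    (hups : upsilon A π S ≤ ENNReal.ofReal R) {v : Fin n → ℂ}
    (hv : ∀ j ∉ S, v j = 0) (hv1 : ‖v‖ ≤ 1) (i : Fin n) :
    ∑ k, π k * ‖sample A π v k i‖ ^ 2 ≤ R := by
  have h1 : ∑ k : Fin n, ENNReal.ofReal
      (‖rowVec A k i‖ ^ 2 * ‖star (restrict S (rowVec A k)) ⬝ᵥ v‖ ^ 2) / ENNReal.ofReal (π k) ≤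
      ENNReal.ofReal R := by
    refine le_trans ?_ hups
    unfold upsilon
    exact le_iSup_of_le i (le_iSup_of_le v (le_iSup_of_le hv1 le_rfl))
  have h2 : ∀ k, star (restrict S (rowVec A k)) ⬝ᵥ v = A.mulVec v k := by
    intro k
    unfold Matrix.mulVec dotProduct
    refine Finset.sum_congr rfl fun j _ => ?_
    by_cases hj : j ∈ S
    · simp [restrict, rowVec, hj]
    · simp [hv j hj]
  have h3 : ∀ k, ‖rowVec A k i‖ = ‖A k i‖ := fun k => by simp [rowVec]
  have hnn : ∀ k, 0 ≤ π k * ‖sample A π v k i‖ ^ 2 := fun k => mul_nonneg (hπ k) (sq_nonneg _)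
  rw [← ENNReal.ofReal_le_ofReal_iff hR, ENNReal.ofReal_sum_of_nonneg fun k _ => hnn k]
  refine le_trans (Finset.sum_le_sum fun k _ => ?_) h1
  rcases (hπ k).eq_or_lt with h0 | h0
  · simp [← h0]
  rw [← ENNReal.ofReal_div_of_pos h0, h2, h3, norm_sample hπ]
  refine le_of_eq (congrArg _ ?_)
  field_simp

/-- An average equal to `1` cannot have all its terms below `1` in modulus. This supplies the `1 ≤
R` required by the Bernstein bounds. -/
theorem one_le_of_sum_mul_sample (hπ : ∀ k, 0 ≤ π k) (hπ1 : ∑ k, π k = 1) {R : ℝ}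
    {v : Fin n → ℂ} {i : Fin n} (hvi : v i = 1) (hbd : ∀ k, ‖sample A π v k i‖ ≤ R)
    (hmean : ∑ k, (π k : ℂ) * sample A π v k i = v i) : 1 ≤ R := by
  calc (1 : ℝ) = ‖∑ k, (π k : ℂ) * sample A π v k i‖ := by rw [hmean, hvi, norm_one]
    _ ≤ ∑ k, π k * R := by
        refine (norm_sum_le _ _).trans (Finset.sum_le_sum fun k _ => ?_)
        rw [norm_mul, Complex.norm_real, Real.norm_eq_abs, abs_of_nonneg (hπ k)]
        exact mul_le_mul_of_nonneg_left (hbd k) (hπ k)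
    _ = R := by rw [← Finset.sum_mul, hπ1, one_mul]

theorem weight_inv_mul_mulVec_eq_zero (hπ : ∀ k, 0 ≤ π k) {m : ℕ} {K : Fin m → Fin n}
    {h : Fin n → ℂ} (hh : (sensingMatrix A π m K).mulVec h = 0) (ℓ : Fin m) :
    (((π (K ℓ))⁻¹ : ℝ) : ℂ) * A.mulVec h (K ℓ) = 0 := by
  -- At zero weight `0⁻¹ = 0` makes the claim trivial; nothing is asserted about `a_k^* h`.
  rcases (hπ (K ℓ)).eq_or_lt with h0 | h0
  · simp [← h0]
  have hm : 0 < m := ℓ.pos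
  have h1 : (sensingMatrix A π m K).mulVec h ℓ =
      ((1 / Real.sqrt m : ℝ) : ℂ) * ((1 / Real.sqrt (π (K ℓ)) : ℝ) : ℂ) * A.mulVec h (K ℓ) := by
    unfold Matrix.mulVec dotProduct sensingMatrix
    rw [Finset.mul_sum]
    refine Finset.sum_congr rfl fun j _ => ?_
    simp [rowVec, mul_assoc]
  rw [hh, Pi.zero_apply] at h1
  have h2 : ((1 / Real.sqrt m : ℝ) : ℂ) ≠ 0 := by
    rw [Complex.ofReal_ne_zero]
    positivity
  have h3 : ((1 / Real.sqrt (π (K ℓ)) : ℝ) : ℂ) ≠ 0 := by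
    rw [Complex.ofReal_ne_zero]
    positivity
  rw [(mul_eq_zero.1 h1.symm).resolve_left (mul_ne_zero h2 h3), mul_zero]

end Conditions

/-! ### Numerical estimates -/

theorem log_two_add_one_le {s : ℕ} (hs : 2 ≤ s) :
    ((Nat.log 2 s + 1 : ℕ) : ℝ) ≤ 3 * Real.log s := by
  have hl := Real.log_two_gt_d9
  have h1 : (Nat.log 2 s : ℝ) * Real.log 2 ≤ Real.log s := by
    rw [← Real.log_pow]
    refine Real.log_le_log (by positivity) ?_
    exact_mod_cast Nat.pow_log_le_self 2 (by omega)
  have h2 : Real.log 2 ≤ Real.log s :=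
    Real.log_le_log (by norm_num) (by exact_mod_cast hs)
  have h3 : (0 : ℝ) ≤ Nat.log 2 s := Nat.cast_nonneg _
  push_cast
  nlinarith

/-- From `s + 1 ≤ 2^L` and `4 s ≤ (s + 1)²`, where `L` is the exponent. -/
theorem four_mul_mul_pow_log_le_one (s : ℕ) :
    4 * (s : ℝ) * (1 / 4) ^ (Nat.log 2 s + 1) ≤ 1 := by
  have h1 : (s : ℝ) + 1 ≤ 2 ^ (Nat.log 2 s + 1) := by
    exact_mod_cast Nat.lt_pow_succ_log_self (b := 2) (by norm_num) s
  have h2 : ((s : ℝ) + 1) ^ 2 ≤ 4 ^ (Nat.log 2 s + 1) := by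
    calc ((s : ℝ) + 1) ^ 2 ≤ (2 ^ (Nat.log 2 s + 1)) ^ 2 :=
          pow_le_pow_left₀ (by positivity) h1 2
      _ = 4 ^ (Nat.log 2 s + 1) := by rw [← pow_mul, mul_comm, pow_mul]; norm_num
  rw [one_div, inv_pow, ← div_eq_mul_inv, div_le_one (by positivity)]
  nlinarith [sq_nonneg ((s : ℝ) - 1)]

/-- Dividing `6000` by the `3` in `L ≤ 3a` leaves `2000 R u`; rounding down costs `1 ≤ 2 R u`. The
target `1536 = 6 · 256` makes each Bernstein factor at most `(ε/n)^6`. -/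
theorem batch_size_ge {m L : ℕ} {R a u : ℝ} (hR : 1 ≤ R) (ha : 0 < a) (hu : 1 / 2 ≤ u)
    (hL : 0 < L) (hLa : (L : ℝ) ≤ 3 * a) (hm : (m : ℝ) = 6000 * R * (a * u)) :
    1536 * (R * u) ≤ ((m / L : ℕ) : ℝ) := by
  have h1 : (m : ℝ) ≤ L * ((m / L : ℕ) + 1) := by
    exact_mod_cast (Nat.lt_mul_div_succ m hL).le
  have h2 : (m : ℝ) ≤ 3 * a * ((m / L : ℕ) + 1) :=
    h1.trans (mul_le_mul_of_nonneg_right hLa (by positivity))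
  have h3 : a * (2000 * (R * u)) ≤ a * ((m / L : ℕ) + 1) := by linarith
  have h4 := le_of_mul_le_mul_left h3 ha
  have h5 : 1 / 2 ≤ R * u := by nlinarith
  linarith

theorem union_bound_le {n s q L : ℕ} {R ε : ℝ} (hR : 1 ≤ R) (hε : 0 < ε) (hε1 : ε < 1)
    (hn : 2 ≤ n) (hsn : s ≤ n) (hLs : L ≤ s)
    (hq : 1536 * (R * Real.log (n / ε)) ≤ q) :
    ((s : ℝ) + 1) * (L * (n * (4 * Real.exp (-(q / (256 * R)))))) ≤ ε := by
  have hn' : (2 : ℝ) ≤ n := by exact_mod_cast hn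
  have hn0 : (0 : ℝ) < n := by linarith
  have h1 : Real.exp (-(q / (256 * R))) ≤ (ε / n) ^ 6 := by
    have h2 : (ε / n) ^ 6 = Real.exp (-(6 * Real.log (n / ε))) := by
      rw [← inv_div (n : ℝ) ε, inv_pow, Real.exp_neg, mul_comm, Real.exp_mul,
        Real.exp_log (by positivity)]
      norm_cast
    rw [h2, Real.exp_le_exp, neg_le_neg_iff, le_div_iff₀ (by positivity)]
    linarith
  have hs1 : (s : ℝ) + 1 ≤ 2 * n := by
    have : (s : ℝ) ≤ n := by exact_mod_cast hsn
    linarith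
  have hL1 : (L : ℝ) ≤ n := by exact_mod_cast hLs.trans hsn
  -- The bound is `8 ε^6 / n^3`, and `n ≥ 2` absorbs the `8`.
  calc _ ≤ (2 * (n : ℝ)) * (n * (n * (4 * (ε / n) ^ 6))) := by gcongr
    _ = ε * (ε ^ 5 * (8 / n ^ 3)) := by field_simp; ring
    _ ≤ ε * (1 * 1) := by
        gcongr
        · exact pow_le_one₀ hε.le hε1.le
        · rw [div_le_one (by positivity)]
          calc (8 : ℝ) = 2 ^ 3 := by norm_num
            _ ≤ n ^ 3 := by gcongr
    _ = ε := by ring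

theorem le_ofReal_div_of_mul_le {a : ℝ≥0∞} {c l : ℝ} {m : ℕ} (hc : 0 < c) (hl : 0 < l)
    (h : ENNReal.ofReal c * a * ENNReal.ofReal l ≤ (m : ℝ≥0∞)) :
    a ≤ ENNReal.ofReal (m / (c * l)) := by
  rw [ENNReal.ofReal_div_of_pos (mul_pos hc hl), ENNReal.ofReal_natCast,
    ENNReal.le_div_iff_mul_le (Or.inl (by simpa using mul_pos hc hl))
      (Or.inl ENNReal.ofReal_ne_top), ENNReal.ofReal_mul hc.le]
  calc _ = ENNReal.ofReal c * a * ENNReal.ofReal l := by ring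
    _ ≤ m := h

/-! ### Recovery -/

section Recovery

variable {n m : ℕ} {A : Matrix (Fin n) (Fin n) ℂ} {π : Fin n → ℝ} {S : Finset (Fin n)}

/-- The vectors approximated by golfing: the sign pattern of `x` and the unit vectors on `S`. -/
noncomputable def golfTargets (S : Finset (Fin n)) (x : Fin n → ℂ) : Finset (Fin n → ℂ) :=
  open Classical in insert (fun i => x i / ‖x i‖) (S.image fun j => Pi.single j 1)

theorem card_golfTargets_le (x : Fin n → ℂ) : (golfTargets S x).card ≤ S.card + 1 := by
  classical
  unfold golfTargets
  exact (Finset.card_insert_le _ _).trans (Nat.succ_le_succ Finset.card_image_le)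

theorem golfTargets_spec {x v : Fin n → ℂ} (hx : ∀ j ∉ S, x j = 0) (hv : v ∈ golfTargets S x) :
    ‖v‖ ≤ 1 ∧ ∀ j ∉ S, v j = 0 := by
  classical
  unfold golfTargets at hv
  rw [Finset.mem_insert, Finset.mem_image] at hv
  rcases hv with rfl | ⟨j, hj, rfl⟩
  · refine ⟨(pi_norm_le_iff_of_nonneg zero_le_one).2 fun i => ?_, fun j hj => by simp [hx j hj]⟩
    rw [norm_div, Complex.norm_real, norm_norm]
    exact div_self_le_one _
  · refine ⟨(pi_norm_le_iff_of_nonneg zero_le_one).2 fun i => ?_, fun i hi => ?_⟩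
    · by_cases h : i = j
      · subst h; simp
      · simp [h]
    · rw [Pi.single_eq_of_ne]
      rintro rfl
      exact hi hj

theorem isUniqueL1Solution_of_forall_notMem_golfFailure (hπ : ∀ k, 0 ≤ π k) (hS : 0 < S.card)
    {x : Fin n → ℂ} (hx : ∀ j ∉ S, x j = 0) {k : Fin m → Fin n} {B : ℕ → Finset (Fin m)} {L : ℕ}
    (hL : 4 * (S.card : ℝ) * (1 / 4) ^ L ≤ 1)
    (hgood : ∀ v ∈ golfTargets S x, ∀ t < L, ∀ i, k ∉ golfFailure A π S B v t i) :
    IsUniqueL1Solution (sensingMatrix A π m k) ((sensingMatrix A π m k).mulVec x) x := by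
  classical
  refine ⟨rfl, fun z hz hzx => ?_⟩
  have hker : (sensingMatrix A π m k).mulVec (z - x) = 0 := by
    rw [Matrix.mulVec_sub, hz, sub_self]
  have key : ∀ v ∈ golfTargets S x, ‖∑ i, star (v i) * (z - x) i‖ ≤
      (1 / 4) ^ L * ∑ j ∈ S, ‖(z - x) j‖ + 1 / 3 * ∑ j ∈ Sᶜ, ‖(z - x) j‖ := fun v hv =>
    norm_star_dotProduct_le (golfTargets_spec hx hv).1 (golfTargets_spec hx hv).2 (hgood v hv)
      (weight_inv_mul_mulVec_eq_zero hπ hker)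
  have := l1Norm_lt_of_certificates (h := z - x) hx (sub_ne_zero.2 hzx) hL (by positivity) hS
    (key _ (Finset.mem_insert_self _ _)) fun j hj => by
      have h1 := key (Pi.single j 1)
        (Finset.mem_insert_of_mem (Finset.mem_image_of_mem _ hj))
      have h2 : ∑ i, star ((Pi.single j 1 : Fin n → ℂ) i) * (z - x) i = (z - x) j := by
        rw [Finset.sum_eq_single j]
        · simp
        · intro i _ hij
          simp [hij]
        · simp
      rwa [h2] at h1
  rwa [add_sub_cancel] at this

end Recovery

end IsolatedCS

/-! ### Choice of parameters and union bound. -/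

theorem mainTheorem6 :
    ∃ C : ℝ, 0 < C ∧
      ∀ (n N m : ℕ)
        -- the unitary matrix, the drawing distribution, the levels
        (A₀ : Matrix (Fin n) (Fin n) ℂ) (_ : A₀ ∈ Matrix.unitaryGroup (Fin n) ℂ)
        (π : Fin n → ℝ) (_ : π ∈ stdSimplex ℝ (Fin n))
        (Lev : Fin N → Finset (Fin n))
        (_ : Pairwise fun i j => Disjoint (Lev i) (Lev j))
        (_ : ∀ j : Fin n, ∃ i : Fin N, j ∈ Lev i)
        -- the support and the signal
        (S : Finset (Fin n)) (s : ℕ) (_ : S.card = s) (_ : 2 ≤ s)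
        (sLev : Fin N → ℕ) (_ : ∀ i, (S ∩ Lev i).card = sLev i)
        (x : Fin n → ℂ) (_ : ∀ j, j ∉ S → x j = 0)
        (ε : ℝ) (_ : 0 < ε) (_ : ε < 1)
        -- the i.i.d. draws
        (Ω : Type*) (_ : MeasurableSpace Ω) (P : MeasureTheory.Measure Ω)
        (_ : MeasureTheory.IsProbabilityMeasure P)
        (K : Fin m → Ω → Fin n) (_ : ∀ ℓ, Measurable (K ℓ))
        (_ : ProbabilityTheory.iIndepFun K P)
        (_ : ∀ ℓ k, P {ω | K ℓ ω = k} = ENNReal.ofReal (π k)),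
        -- the two conditions on the number of measurements
        ENNReal.ofReal C * IsolatedCS.levelCoherence A₀ π Lev sLev *
            ENNReal.ofReal (Real.log s * Real.log (n / ε)) ≤ (m : ℝ≥0∞) →
        ENNReal.ofReal C * IsolatedCS.upsilon A₀ π S *
            ENNReal.ofReal (Real.log s * Real.log (n / ε)) ≤ (m : ℝ≥0∞) →
        1 - ε ≤ P.real {ω |
          IsolatedCS.IsUniqueL1Solution
            (IsolatedCS.sensingMatrix A₀ π m fun ℓ => K ℓ ω)
            ((IsolatedCS.sensingMatrix A₀ π m fun ℓ => K ℓ ω).mulVec x) x} := by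
  open IsolatedCS MeasureTheory in
  classical
  refine ⟨6000, by norm_num, ?_⟩
  intro n N m A hA π hπs Lev hdisj hcov S s hSs hs sLev hsLev x hx ε hε hε1 Ω _ P _ K hK hind hlaw
    hcoh hups
  have hπ : ∀ k, 0 ≤ π k := hπs.1
  have hπ1 : ∑ k, π k = 1 := hπs.2
  have hsn : s ≤ n := by
    rw [← hSs]
    exact (Finset.card_le_univ S).trans (by simp)
  have hn : 2 ≤ n := hs.trans hsn
  have hn' : (2 : ℝ) ≤ n := by exact_mod_cast hn
  have ha : 0 < Real.log s := Real.log_pos (by exact_mod_cast hs)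
  have hu : 1 / 2 ≤ Real.log (n / ε) := by
    have h1 : Real.log 2 ≤ Real.log (n / ε) := by
      refine Real.log_le_log (by norm_num) ?_
      rw [le_div_iff₀ hε]
      linarith
    have := Real.log_two_gt_d9
    linarith
  have hl : 0 < Real.log s * Real.log (n / ε) := mul_pos ha (by linarith)
  -- `R` is the largest value that `m` draws can afford; both hypotheses on `m` become upper bounds
  -- by `R`.
  set R : ℝ := m / (6000 * (Real.log s * Real.log (n / ε))) with hRdef
  have hR0 : 0 ≤ R := by positivity
  have hcoh' := sum_norm_mul_le_of_levelCoherence_le hπ hdisj hcov hsLev hR0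
    (le_ofReal_div_of_mul_le (by norm_num) hl hcoh)
  have hups' := le_ofReal_div_of_mul_le (by norm_num) hl hups
  obtain ⟨j₀, hj₀⟩ : S.Nonempty := Finset.card_pos.1 (by omega)
  have hR : 1 ≤ R := by
    have hspec := golfTargets_spec (v := Pi.single j₀ 1) hx
      (Finset.mem_insert_of_mem (Finset.mem_image_of_mem _ hj₀))
    exact one_le_of_sum_mul_sample (i := j₀) hπ hπ1 (Pi.single_eq_same j₀ 1)
      (fun k => norm_sample_le hπ hR0 hcoh' hspec.2 hspec.1 k j₀)
      (sum_mul_sample hA hcoh' hspec.2 j₀)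
  have hm : (m : ℝ) = 6000 * R * (Real.log s * Real.log (n / ε)) := by
    rw [hRdef]
    field_simp
  set L := Nat.log 2 s + 1 with hLdef
  set q := m / L with hqdef
  have hq := batch_size_ge hR ha hu (Nat.succ_pos _) (log_two_add_one_le hs) hm
  have hq0 : 0 < q := by
    have : (0 : ℝ) < q := lt_of_lt_of_le (by positivity) hq
    exact_mod_cast this
  obtain ⟨B, hBcard, hBdisj⟩ := exists_batches (m := m) (Nat.mul_div_le m L)
  set bad : Set Ω := ⋃ v ∈ golfTargets S x, ⋃ t ∈ Finset.range L, ⋃ i,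
    {ω | (fun ℓ => K ℓ ω) ∈ golfFailure A π S B v t i}
  have hbad : P.real bad ≤ ε := by
    calc P.real bad
        ≤ ∑ v ∈ golfTargets S x, ∑ t ∈ Finset.range L, ∑ i : Fin n,
            4 * Real.exp (-(q / (256 * R))) := by
          refine (measureReal_biUnion_finset_le _ _).trans (Finset.sum_le_sum fun v hv => ?_)
          refine (measureReal_biUnion_finset_le _ _).trans (Finset.sum_le_sum fun t ht => ?_)
          refine (measureReal_iUnion_fintype_le _).trans (Finset.sum_le_sum fun i _ => ?_)
          exact measureReal_golfFailure_le hπ hπ1 hK hind hlaw hR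
            (fun w hw hw1 => norm_sample_le hπ hR0 hcoh' hw hw1)
            (fun w hw hw1 => sum_mul_norm_sample_sq_le hπ hR0 hups' hw hw1)
            (fun w hw => sum_mul_sample hA hcoh' hw) hq0 (hBcard t (Finset.mem_range.1 ht))
            (fun t' ht' => hBdisj t' t ht') j₀ (golfTargets_spec hx hv).2 i
      _ = (golfTargets S x).card * (L * (n * (4 * Real.exp (-(q / (256 * R)))))) := by simp
      _ ≤ ((s : ℝ) + 1) * (L * (n * (4 * Real.exp (-(q / (256 * R)))))) := by
          refine mul_le_mul_of_nonneg_right ?_ (by positivity)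
          exact_mod_cast hSs ▸ card_golfTargets_le x
      _ ≤ ε := union_bound_le hR hε hε1 hn hsn (Nat.log_lt_self 2 (by omega)) hq
  set good : Set Ω := {ω | IsUniqueL1Solution (sensingMatrix A π m fun ℓ => K ℓ ω)
    ((sensingMatrix A π m fun ℓ => K ℓ ω).mulVec x) x}
  -- Covering plus subadditivity gives the lower bound on `good` without proving it measurable.
  have hcover : good ∪ bad = Set.univ := by
    refine Set.eq_univ_of_forall fun ω => ?_
    by_cases hω : ω ∈ bad
    · exact Or.inr hω
    refine Or.inl (isUniqueL1Solution_of_forall_notMem_golfFailure (B := B) (L := L) hπ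
      (by omega) hx (by rw [hSs]; exact four_mul_mul_pow_log_le_one s) ?_)
    intro v hv t ht i hf
    exact hω (Set.mem_biUnion hv (Set.mem_biUnion (Finset.mem_range.2 ht)
      (Set.mem_iUnion.2 ⟨i, hf⟩)))
  have hunion := measureReal_union_le (μ := P) good bad
  rw [hcover, probReal_univ] at hunion
  linarith
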